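/- Let $(X,d,\mu)$ be a metric measure space: a metric space with a non-negative Borel measure such that $0<\mu(B(x,r))<\infty$ for all $x\in X$, $r\in(0,\infty)$. **Exponents.** $\mathcal P(X)$ is the set of measurable $q:X\to(0,\infty]$ with $\operatorname{ess\,inf} q>0$; $\mathcal P_b(X)$ is the set of essentially bounded, finite-valued $p\in\mathcal P(X)$; $\mathcal P_b^{\log}(X)$ is the set of $p\in\mathcal P_b(X)$ for which there is $C>0$ with $|1/p(x)-1/p(y)|\le C/\log(e+1/d(x,y))$ for all $x\neq y$. Write $f\ll g$ if $\operatorname{ess\,inf}(g-f)>0$. **Function spaces.** For $p\in\mathcal P_b(X)$ put $\rho_{p(\cdot)}(u)=\int_X|u(x)|^{p(x)}\,d\mu(x)$, let $L^{p(\cdot)}(X)$ be the space of measurable, a.e. finite $u$ with $\rho_{p(\cdot)}(u)<\infty$, and $\|u\|_{L^{p(\cdot)}}=\inf\{\lambda>0:\rho_{p(\cdot)}(u/\lambda)\le1\}$. For sequences $g=\{g_k\}_{k\in\mathbb Z}$ of measurable functions and $q\in\mathcal P(X)$ put $\|g\|_{L^{p(\cdot)}(\ell^{q(\cdot)})}=\big\|\,\|\{g_k(\cdot)\}_k\|_{\ell^{q(\cdot)}}\big\|_{L^{p(\cdot)}}$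 and $\|g\|_{\ell^{q(\cdot)}(L^{p(\cdot)})}=\inf\{\lambda>0:\rho(g/\lambda)\le1\}$, where $\rho(g)=\sum_{k\in\mathbb Z}\inf\{\lambda_k>0:\rho_{p(\cdot)}(g_k/\lambda_k^{1/q(\cdot)})\le1\}$, with $\lambda^{1/\infty}=1$ and $\inf\emptyset=\infty$. For $s\in\mathcal P_b(X)$ and a measurable, a.e. finite $u:X\to[-\infty,\infty]$, let $\mathbb D^{s(\cdot)}(u)$ be the set of sequences $\{g_k\}_{k\in\mathbb Z}$ of measurable $g_k:X\to[0,\infty]$ for which there is a $\mu$-null set $N$ such that $$|u(x)-u(y)|\le d(x,y)^{s(x)}g_k(x)+d(x,y)^{s(y)}g_k(y)$$ for all $k\in\mathbb Z$ and $x,y\in X\setminus N$ with $2^{-k-1}\le d(x,y)<2^{-k}$. The Hajłasz–Triebel–Lizorkin space $M^{s(\cdot)}_{p(\cdot),q(\cdot)}(X,d,\mu)$ consists of all $u\in L^{p(\cdot)}(X)$ with finite quasi-norm $\|u\|_{L^{p(\cdot)}}+\inf_{g\in\mathbb D^{s(\cdot)}(u)}\|g\|_{L^{p(\cdot)}(\ell^{q(\cdot)})}$,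 and the Hajłasz–Besov space $N^{s(\cdot)}_{p(\cdot),q(\cdot)}(X,d,\mu)$ of all $u\in L^{p(\cdot)}(X)$ with finite quasi-norm $\|u\|_{L^{p(\cdot)}}+\inf_{g\in\mathbb D^{s(\cdot)}(u)}\|g\|_{\ell^{q(\cdot)}(L^{p(\cdot)})}$. For a bounded $\alpha:X\to[0,\infty)$, $C^{0,\alpha(\cdot)}(X,d)$ is the space of continuous $v:X\to\mathbb R$ with $$\|v\|_{C^{0,\alpha(\cdot)}}=\sup_{x}|v(x)|+\sup_{x\ne y}\frac{|v(x)-v(y)|}{d(x,y)^{\alpha(x)}}<\infty .$$ For a function space $V$ as above, $V\hookrightarrow C^{0,\alpha(\cdot)}(X,d)$ means that there is a constant $C$ such that every $u\in V$ agrees $\mu$-a.e. with some $v\in C^{0,\alpha(\cdot)}(X,d)$ satisfying $\|v\|_{C^{0,\alpha(\cdot)}}\le C\|u\|_V$. **Theorem.** Let $Q\in\mathcal P_b^{\log}(X)$ and suppose that $\mu$ is lower Ahlfors $Q(\cdot)$-regular, i.e. there is $b>0$ with $\mu(B(x,r))\ge b\,r^{Q(x)}$ for all $x\in X$, $r\in(0,1]$.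 Let $p,s\in\mathcal P_b^{\log}(X)$ with $Q\ll sp$. Then $\alpha:=s-Q/p$ is bounded and non-negative, and 1. for every $q\in\mathcal P(X)$, $M^{s(\cdot)}_{p(\cdot),q(\cdot)}(X,d,\mu)\hookrightarrow C^{0,\alpha(\cdot)}(X,d)$; 2. for every $q\in\mathcal P(X)$ with $q\le p$ on $X$, $N^{s(\cdot)}_{p(\cdot),q(\cdot)}(X,d,\mu)\hookrightarrow C^{0,\alpha(\cdot)}(X,d)$; 3. for every $q\in\mathcal P(X)$ and every $t\in\mathcal P_b^{\log}(X)$ with $Q\ll tp\ll sp$, the function $\lambda:=t-Q/p$ is bounded and non-negative, and $N^{s(\cdot)}_{p(\cdot),q(\cdot)}(X,d,\mu)\hookrightarrow C^{0,\lambda(\cdot)}(X,d)$. -/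

import Mathlib

open MeasureTheory
open scoped ENNReal NNReal

namespace VarExp

variable {X : Type*}

/-! ### Metric measure spaces and exponents -/

/-- `μ` makes the metric space `X` a metric measure space: every ball of positive finite radius
has positive and finite measure. -/
def IsMetricMeasure [MetricSpace X] [MeasurableSpace X] (μ : Measure X) : Prop :=
  ∀ (x : X) (r : ℝ), 0 < r → 0 < μ (Metric.ball x r) ∧ μ (Metric.ball x r) < ∞

/-- `μ` is lower Ahlfors `Q(·)`-regular. -/
def LowerAhlforsRegular [MetricSpace X] [MeasurableSpace X] (μ : Measure X) (Q : X → ℝ) : Prop :=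
  ∃ b : ℝ, 0 < b ∧ ∀ (x : X) (r : ℝ), 0 < r → r ≤ 1 →
    ENNReal.ofReal (b * r ^ Q x) ≤ μ (Metric.ball x r)

/-- The class `𝒫(X)`: measurable functions `q : X → (0, ∞]` whose essential infimum is
positive. -/
structure IsExponent [MeasurableSpace X] (μ : Measure X) (q : X → ℝ≥0∞) : Prop where
  measurable : Measurable q
  pos : ∀ x, 0 < q x
  essInf_pos : ∃ c : ℝ≥0∞, 0 < c ∧ ∀ᵐ x ∂μ, c ≤ q x

/-- The class `𝒫_b(X)` of (finite-valued) exponents which are essentially bounded and whose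
essential infimum is positive. -/
structure IsBddExponent [MeasurableSpace X] (μ : Measure X) (p : X → ℝ) : Prop where
  measurable : Measurable p
  pos : ∀ x, 0 < p x
  essInf_pos : ∃ c : ℝ, 0 < c ∧ ∀ᵐ x ∂μ, c ≤ p x
  essBdd : ∃ C : ℝ, ∀ᵐ x ∂μ, p x ≤ C

/-- Local log-Hölder continuity (for `x = y` the inequality is trivially true). -/
def LogHolder [MetricSpace X] (f : X → ℝ) : Prop :=
  ∃ C : ℝ, 0 < C ∧ ∀ x y : X, |f x - f y| ≤ C / Real.log (Real.exp 1 + 1 / dist x y)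

/-- The class `𝒫_b^log(X)`: exponents `p ∈ 𝒫_b(X)` such that `1/p` is locally log-Hölder
continuous. -/
structure IsBddLogExponent [MetricSpace X] [MeasurableSpace X] (μ : Measure X) (p : X → ℝ) : Prop
    extends IsBddExponent μ p where
  logHolder : LogHolder (fun x => 1 / p x)

/-- `f ≪ g`, i.e. the essential infimum of `g - f` is positive. -/
def MuchLess [MeasurableSpace X] (μ : Measure X) (f g : X → ℝ) : Prop :=
  ∃ c : ℝ, 0 < c ∧ ∀ᵐ x ∂μ, c ≤ g x - f x

/-! ### Variable exponent Lebesgue spaces and mixed Lebesgue-sequence spaces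

Functions enter through their absolute values, which take values in `[0, ∞]`. Quasi-norms take
values in `[0, ∞]`, with `inf ∅ = ∞`. -/

/-- The semi-modular `∫ |f|^{p(x)} dμ(x)`. -/
noncomputable def modular [MeasurableSpace X] (μ : Measure X) (p : X → ℝ) (f : X → ℝ≥0∞) : ℝ≥0∞ :=
  ∫⁻ x, f x ^ p x ∂μ

/-- The Luxemburg quasi-norm of `L^{p(·)}`. -/
noncomputable def lpNorm [MeasurableSpace X] (μ : Measure X) (p : X → ℝ) (f : X → ℝ≥0∞) : ℝ≥0∞ :=
  sInf {l : ℝ≥0∞ | 0 < l ∧ l < ∞ ∧ modular μ p (fun x => f x / l) ≤ 1}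

/-- The pointwise `ℓ^{q(x)}`-quasi-norm of a sequence. -/
noncomputable def seqNorm (q : ℝ≥0∞) (a : ℤ → ℝ≥0∞) : ℝ≥0∞ :=
  if q = ∞ then ⨆ k, a k else (∑' k, a k ^ q.toReal) ^ (1 / q.toReal)

/-- The quasi-norm of `L^{p(·)}(ℓ^{q(·)})`. -/
noncomputable def lpSeqNorm [MeasurableSpace X] (μ : Measure X) (p : X → ℝ) (q : X → ℝ≥0∞)
    (g : ℤ → X → ℝ≥0∞) : ℝ≥0∞ :=
  lpNorm μ p (fun x => seqNorm (q x) (fun k => g k x))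

/-- The semi-modular of `ℓ^{q(·)}(L^{p(·)})`, where `l^{1/∞} = 1`. -/
noncomputable def seqLpModular [MeasurableSpace X] (μ : Measure X) (p : X → ℝ) (q : X → ℝ≥0∞)
    (g : ℤ → X → ℝ≥0∞) : ℝ≥0∞ :=
  ∑' k, sInf {l : ℝ≥0∞ | 0 < l ∧ l < ∞ ∧
    modular μ p (fun x => g k x / l ^ ((q x)⁻¹).toReal) ≤ 1}

/-- The quasi-norm of `ℓ^{q(·)}(L^{p(·)})`. -/
noncomputable def seqLpNorm [MeasurableSpace X] (μ : Measure X) (p : X → ℝ) (q : X → ℝ≥0∞)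
    (g : ℤ → X → ℝ≥0∞) : ℝ≥0∞ :=
  sInf {l : ℝ≥0∞ | 0 < l ∧ l < ∞ ∧ seqLpModular μ p q (fun k x => g k x / l) ≤ 1}

/-- The space `L^{p(·)}(X, μ)`, as a set of extended-real-valued functions. -/
def LpSpace [MeasurableSpace X] (μ : Measure X) (p : X → ℝ) : Set (X → EReal) :=
  {u | Measurable u ∧ modular μ p (fun x => (u x).abs) < ∞}

/-! ### Hajłasz-Triebel-Lizorkin and Hajłasz-Besov spaces -/

/-- The set `𝔻^{s(·)}(u)` of vector `s(·)`-gradients of `u`. -/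
def vectorGradients [MetricSpace X] [MeasurableSpace X] (μ : Measure X) (s : X → ℝ)
    (u : X → EReal) : Set (ℤ → X → ℝ≥0∞) :=
  {g | (∀ k, Measurable (g k)) ∧ ∃ N : Set X, μ N = 0 ∧ ∀ (k : ℤ) (x y : X), x ∉ N → y ∉ N →
    (2 : ℝ) ^ (-k - 1) ≤ dist x y → dist x y < (2 : ℝ) ^ (-k) →
    (u x - u y).abs ≤
      ENNReal.ofReal (dist x y ^ s x) * g k x + ENNReal.ofReal (dist x y ^ s y) * g k y}

/-- The quasi-seminorm of the homogeneous Hajłasz-Triebel-Lizorkin space. -/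
noncomputable def homTriebelLizorkinNorm [MetricSpace X] [MeasurableSpace X] (μ : Measure X)
    (s p : X → ℝ) (q : X → ℝ≥0∞) (u : X → EReal) : ℝ≥0∞ :=
  ⨅ g ∈ vectorGradients μ s u, lpSeqNorm μ p q g

/-- The quasi-seminorm of the homogeneous Hajłasz-Besov space. -/
noncomputable def homBesovNorm [MetricSpace X] [MeasurableSpace X] (μ : Measure X)
    (s p : X → ℝ) (q : X → ℝ≥0∞) (u : X → EReal) : ℝ≥0∞ :=
  ⨅ g ∈ vectorGradients μ s u, seqLpNorm μ p q g

/-- The homogeneous Hajłasz-Triebel-Lizorkin space. -/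
def HomTriebelLizorkin [MetricSpace X] [MeasurableSpace X] (μ : Measure X)
    (s p : X → ℝ) (q : X → ℝ≥0∞) : Set (X → EReal) :=
  {u | Measurable u ∧ (∀ᵐ x ∂μ, u x ≠ ⊤ ∧ u x ≠ ⊥) ∧ homTriebelLizorkinNorm μ s p q u < ∞}

/-- The homogeneous Hajłasz-Besov space. -/
def HomBesov [MetricSpace X] [MeasurableSpace X] (μ : Measure X)
    (s p : X → ℝ) (q : X → ℝ≥0∞) : Set (X → EReal) :=
  {u | Measurable u ∧ (∀ᵐ x ∂μ, u x ≠ ⊤ ∧ u x ≠ ⊥) ∧ homBesovNorm μ s p q u < ∞}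

/-- The Hajłasz-Triebel-Lizorkin space `M^{s(·)}_{p(·),q(·)}(X, d, μ)`. -/
def TriebelLizorkin [MetricSpace X] [MeasurableSpace X] (μ : Measure X)
    (s p : X → ℝ) (q : X → ℝ≥0∞) : Set (X → EReal) :=
  HomTriebelLizorkin μ s p q ∩ LpSpace μ p

/-- The Hajłasz-Besov space `N^{s(·)}_{p(·),q(·)}(X, d, μ)`. -/
def Besov [MetricSpace X] [MeasurableSpace X] (μ : Measure X)
    (s p : X → ℝ) (q : X → ℝ≥0∞) : Set (X → EReal) :=
  HomBesov μ s p q ∩ LpSpace μ p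

/-- The quasi-norm of `M^{s(·)}_{p(·),q(·)}(X, d, μ)`. -/
noncomputable def triebelLizorkinNorm [MetricSpace X] [MeasurableSpace X] (μ : Measure X)
    (s p : X → ℝ) (q : X → ℝ≥0∞) (u : X → EReal) : ℝ≥0∞ :=
  lpNorm μ p (fun x => (u x).abs) + homTriebelLizorkinNorm μ s p q u

/-- The quasi-norm of `N^{s(·)}_{p(·),q(·)}(X, d, μ)`. -/
noncomputable def besovNorm [MetricSpace X] [MeasurableSpace X] (μ : Measure X)
    (s p : X → ℝ) (q : X → ℝ≥0∞) (u : X → EReal) : ℝ≥0∞ :=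
  lpNorm μ p (fun x => (u x).abs) + homBesovNorm μ s p q u

/-! ### Variable exponent Hölder spaces and embeddings -/

/-- The norm `sup |v| + [v]_{α(·)}` of `C^{0,α(·)}(X, d)`. -/
noncomputable def holderNorm [MetricSpace X] (α : X → ℝ) (v : X → ℝ) : ℝ≥0∞ :=
  (⨆ x, ENNReal.ofReal |v x|) +
    ⨆ (x : X) (y : X) (_ : x ≠ y), ENNReal.ofReal (|v x - v y| / dist x y ^ α x)

/-- The Hölder space `C^{0,α(·)}(X, d)`. -/
def HolderSpace [MetricSpace X] (α : X → ℝ) : Set (X → ℝ) :=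
  {v | Continuous v ∧ holderNorm α v < ∞}

/-- Continuous embedding into `C^{0,α(·)}(X, d)` of a space `V` of functions, identified when equal
almost everywhere, with quasi-norm `n`. The first two clauses say that `α` is an admissible
exponent, i.e. a bounded function `X → [0, ∞)`. -/
def EmbedsInHolder [MetricSpace X] [MeasurableSpace X] (μ : Measure X)
    (V : Set (X → EReal)) (n : (X → EReal) → ℝ≥0∞) (α : X → ℝ) : Prop :=
  (∀ x, 0 ≤ α x) ∧ BddAbove (Set.range α) ∧
  ∃ C : ℝ≥0, ∀ u ∈ V, ∃ v ∈ HolderSpace α,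
    (∀ᵐ x ∂μ, u x = (v x : EReal)) ∧ holderNorm α v ≤ C * n u

end VarExp

namespace VarExp

variable {X : Type*}

/-! The whole statement reduces to one scalar gradient. Suppose `h` lies in `L^{p(·)}` and bounds
`|u x - u y|` by `d^{s x} h x + d^{s y} h y` for all distances `d < 1`. Chebyshev's inequality and
lower regularity give, in every ball of radius `r ≤ 1`, a point `y` with `h y ≲ r^{-Q y / p y}` and
a similar bound on `u y` (`exists_le_of_modular_le_one`). Choosing such points in dyadically
shrinking balls about `x`, consecutive values of `u` differ by at most a multiple of `r^{s - Q/p}`.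
Log-Hölder continuity allows this exponent to be evaluated at the centre, and it is bounded below by
a positive constant. The differences therefore sum geometrically, and the limits define the Hölder
representative (`exists_holder_of_good_points`, `exists_holder_of_hajlasz`). No Poincaré inequality
or doubling is involved.

It remains to extract `h` from a vector gradient `g`, with its modular controlled by the quasi-norm.
For the Triebel–Lizorkin space, and for the Besov space with `q ≤ p`, `h = sup_k g_k` works. For the
Besov space with general `q`, the gap between `t` and `s` pays for a geometric weight, and `h =
sup_{k ≥ 0} τ^k g_k` with `τ < 1` is a gradient of order `t`. -/

/-! ### Log-Hölder exponents -/

theorem LogHolder.continuous [MetricSpace X] {f : X → ℝ} (hf : LogHolder f) : Continuous f := by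
  obtain ⟨C, hC, h⟩ := hf
  refine Metric.continuous_iff.2 fun x ε hε => ⟨Real.exp (-(C / ε)), Real.exp_pos _, fun y hy => ?_⟩
  rcases eq_or_ne y x with rfl | hne
  · simpa using hε
  have hd : 0 < dist y x := dist_pos.2 hne
  rw [Real.dist_eq]
  refine (h y x).trans_lt ?_
  have hinv : Real.exp (C / ε) < 1 / dist y x := by
    rw [lt_div_iff₀ hd, mul_comm, ← lt_div_iff₀ (Real.exp_pos _), one_div, ← Real.exp_neg]
    exact hy
  have hlog : C / ε < Real.log (Real.exp 1 + 1 / dist y x) := by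
    rw [Real.lt_log_iff_exp_lt (by positivity)]
    linarith [Real.exp_pos 1]
  rw [div_lt_iff₀ (lt_trans (by positivity) hlog)]
  rw [div_lt_iff₀ hε] at hlog
  linarith

theorem one_le_log_exp_add [MetricSpace X] (x y : X) :
    1 ≤ Real.log (Real.exp 1 + 1 / dist x y) := by
  rw [Real.le_log_iff_exp_le (by positivity)]
  have : 0 ≤ 1 / dist x y := by positivity
  linarith

theorem LogHolder.sub [MetricSpace X] {f g : X → ℝ} (hf : LogHolder f) (hg : LogHolder g) :
    LogHolder (fun x => f x - g x) := by
  obtain ⟨C, hC, h⟩ := hf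
  obtain ⟨D, hD, h'⟩ := hg
  refine ⟨C + D, by positivity, fun x y => ?_⟩
  rw [add_div]
  have := abs_sub (f x - f y) (g x - g y)
  rw [show f x - g x - (f y - g y) = f x - f y - (g x - g y) by ring]
  linarith [h x y, h' x y]

theorem LogHolder.mul [MetricSpace X] {f g : X → ℝ} {M : ℝ} (hf : LogHolder f) (hg : LogHolder g)
    (hM : 0 < M) (hfM : ∀ x, |f x| ≤ M) (hgM : ∀ x, |g x| ≤ M) :
    LogHolder (fun x => f x * g x) := by
  obtain ⟨C, hC, h⟩ := hf
  obtain ⟨D, hD, h'⟩ := hg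
  refine ⟨M * C + M * D, by positivity, fun x y => ?_⟩
  rw [add_div, mul_div_assoc, mul_div_assoc,
    show f x * g x - f y * g y = g x * (f x - f y) + f y * (g x - g y) by ring]
  refine (abs_add_le _ _).trans ?_
  rw [abs_mul, abs_mul]
  gcongr
  exacts [hgM x, h x y, hfM y, h' x y]

/-- A log-Hölder function is almost constant, as an exponent of `r`, on balls of radius `r`. -/
theorem LogHolder.rpow_le [MetricSpace X] {f : X → ℝ} (hf : LogHolder f) :
    ∃ A : ℝ, 1 ≤ A ∧ ∀ (x y : X) (r : ℝ), 0 < r → r ≤ 1 → dist x y ≤ r →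
      r ^ f x ≤ A * r ^ f y := by
  obtain ⟨C, hC, h⟩ := hf
  refine ⟨Real.exp C, Real.one_le_exp hC.le, fun x y r hr hr1 hd => ?_⟩
  rcases eq_or_ne x y with rfl | hne
  · have := Real.one_le_exp hC.le
    have := Real.rpow_pos_of_pos hr (f x)
    nlinarith
  have hd0 : 0 < dist x y := dist_pos.2 hne
  have hl : 0 ≤ -Real.log r := by linarith [Real.log_nonpos hr.le hr1]
  have hlog := one_le_log_exp_add x y
  -- Since `dist x y ≤ r`, the logarithm in the log-Hölder bound dominates `-log r`, so their
  -- product with the oscillation of `f` stays below `C`.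
  have hle : -Real.log r ≤ Real.log (Real.exp 1 + 1 / dist x y) := by
    rw [← Real.log_inv]
    refine Real.log_le_log (by positivity) ?_
    have : r⁻¹ ≤ 1 / dist x y := by rw [one_div]; gcongr
    linarith [Real.exp_pos 1]
  have key : Real.log r * (f x - f y) ≤ C := by
    have h1 : Real.log r * (f x - f y) ≤ -Real.log r * |f x - f y| := by
      nlinarith [neg_abs_le (f x - f y)]
    refine h1.trans ((mul_le_mul_of_nonneg_left (h x y) hl).trans ?_)
    rw [← mul_div_assoc, div_le_iff₀ (by linarith)]
    nlinarith
  rw [Real.rpow_def_of_pos hr, Real.rpow_def_of_pos hr, ← Real.exp_add]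
  refine Real.exp_le_exp.2 ?_
  linarith

/-- The set where the bound fails is open and null, while balls have positive measure. This turns
every essential bound on a continuous exponent into a pointwise one. -/
theorem IsMetricMeasure.le_of_ae_le [MetricSpace X] [MeasurableSpace X] {μ : Measure X}
    (hμ : IsMetricMeasure μ) {f : X → ℝ} (hf : Continuous f) {c : ℝ} (h : ∀ᵐ x ∂μ, c ≤ f x)
    (x : X) : c ≤ f x := by
  by_contra! hx
  obtain ⟨r, hr, hb⟩ := Metric.isOpen_iff.1 (isOpen_lt hf continuous_const) x hx
  refine (hμ x r hr).1.ne' (measure_mono_null hb ?_)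
  simpa [ae_iff] using h

theorem IsBddLogExponent.continuous [MetricSpace X] [MeasurableSpace X] {μ : Measure X}
    {p : X → ℝ} (hp : IsBddLogExponent μ p) : Continuous p := by
  have : Continuous fun x => (1 / p x)⁻¹ :=
    hp.logHolder.continuous.inv₀ fun x => (one_div_pos.2 (hp.pos x)).ne'
  simpa using this

theorem IsBddLogExponent.exists_bounds [MetricSpace X] [MeasurableSpace X] {μ : Measure X}
    (hμ : IsMetricMeasure μ) {p : X → ℝ} (hp : IsBddLogExponent μ p) :
    ∃ c C : ℝ, 0 < c ∧ 0 < C ∧ ∀ x, c ≤ p x ∧ p x ≤ C := by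
  obtain ⟨c, hc, h⟩ := hp.essInf_pos
  obtain ⟨C, h'⟩ := hp.essBdd
  refine ⟨c, max C 1, hc, by positivity, fun x => ⟨hμ.le_of_ae_le hp.continuous h x, ?_⟩⟩
  have := hμ.le_of_ae_le (f := fun x => -p x) hp.continuous.neg (c := -C)
    (h'.mono fun x hx => neg_le_neg hx) x
  exact le_max_of_le_left (neg_le_neg_iff.1 this)

/-- Log-Hölder continuity is assumed for `1/p`; it passes to `p` because `p` is bounded. -/
theorem IsBddLogExponent.logHolder_self [MetricSpace X] [MeasurableSpace X] {μ : Measure X}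
    (hμ : IsMetricMeasure μ) {p : X → ℝ} (hp : IsBddLogExponent μ p) : LogHolder p := by
  obtain ⟨c, C, hc, hC, hb⟩ := hp.exists_bounds hμ
  obtain ⟨D, hD, h⟩ := hp.logHolder
  refine ⟨C * C * D, by positivity, fun x y => ?_⟩
  have hx := hp.pos x
  have hy := hp.pos y
  rw [show p x - p y = p x * p y * (1 / p y - 1 / p x) by field_simp, abs_mul, mul_div_assoc,
    abs_of_pos (mul_pos hx hy), abs_sub_comm]
  gcongr
  exacts [(hb x).2, (hb y).2, h x y]

theorem IsBddLogExponent.logHolder_sub_div [MetricSpace X] [MeasurableSpace X] {μ : Measure X}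
    (hμ : IsMetricMeasure μ) {Q p s : X → ℝ} (hQ : IsBddLogExponent μ Q)
    (hp : IsBddLogExponent μ p) (hs : IsBddLogExponent μ s) :
    LogHolder (fun x => s x - Q x / p x) := by
  obtain ⟨c, C, hc, hC, hb⟩ := hp.exists_bounds hμ
  obtain ⟨c', C', hc', hC', hb'⟩ := hQ.exists_bounds hμ
  refine (hs.logHolder_self hμ).sub ?_
  simp_rw [div_eq_mul_one_div (Q _)]
  refine (hQ.logHolder_self hμ).mul hp.logHolder (M := max C' (1 / c)) (by positivity)
    (fun x => ?_) fun x => ?_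
  · rw [abs_of_pos (hQ.pos x)]
    exact le_max_of_le_left (hb' x).2
  · rw [abs_of_pos (one_div_pos.2 (hp.pos x))]
    exact le_max_of_le_right (one_div_le_one_div_of_le hc (hb x).1)

theorem MuchLess.exists_forall_le [MetricSpace X] [MeasurableSpace X] {μ : Measure X}
    (hμ : IsMetricMeasure μ) {f g : X → ℝ} (hf : Continuous f) (hg : Continuous g)
    (h : MuchLess μ f g) : ∃ c : ℝ, 0 < c ∧ ∀ x, c ≤ g x - f x := by
  obtain ⟨c, hc, h⟩ := h
  exact ⟨c, hc, hμ.le_of_ae_le (hg.sub hf) h⟩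

/-! ### Chaining through good points -/

/-- Uniform Hölder representative from a pointwise gradient `H` which, in every ball of radius
`r ≤ 1`, is at most `K * r ^ (-φ)` at some point. -/
theorem exists_holder_of_good_points [MetricSpace X] {s φ : X → ℝ} {a S F : ℝ} (ha : 0 < a)
    (hα : LogHolder (fun x => s x - φ x)) (hs : ∀ x, 0 < s x) (hsS : ∀ x, s x ≤ S)
    (haα : ∀ x, a ≤ s x - φ x) (hφ : ∀ x, 0 ≤ φ x) (hφF : ∀ x, φ x ≤ F) :
    ∃ C : ℝ, 0 < C ∧ ∀ (K : ℝ) (w H : X → ℝ) (G : Set X), 0 < K →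
      (∀ x ∈ G, ∀ y ∈ G, dist x y < 1 →
        |w x - w y| ≤ dist x y ^ s x * H x + dist x y ^ s y * H y) →
      (∀ x r, 0 < r → r ≤ 1 → ∃ y ∈ G, dist y x < r ∧ |w y| ≤ K * r ^ (-φ y) ∧
        H y ≤ K * r ^ (-φ y)) →
      ∃ v : X → ℝ, (∀ x ∈ G, v x = w x) ∧ (∀ x, |v x| ≤ C * K) ∧
        ∀ x y, |v x - v y| ≤ C * K * dist x y ^ (s x - φ x) := by
  obtain ⟨A, hA1, hA⟩ := hα.rpow_le
  have hA0 : 0 < A := by linarith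
  set B : ℝ := 4 ^ S * A with hB
  have hB0 : 0 < B := by positivity
  set θ : ℝ := (1 / 2) ^ a with hθ
  have hθ1 : θ < 1 := Real.rpow_lt_one (by norm_num) (by norm_num) ha
  -- The factor 2 counts the two terms of the gradient inequality; the rest bounds the geometric
  -- series of the chain.
  set E : ℝ := 2 * (1 / (1 - θ)) with hE
  have hE0 : 0 < E := by
    have : 0 < 1 - θ := by linarith
    positivity
  -- `C₁` bounds `|v|`: the value at the first good point (radius 1/4) plus the length of the chain.
  -- `C₂` and `C₃` give the Hölder bound at distances at most and above 1/4.
  set C₁ : ℝ := 4 ^ F + B * E with hC₁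
  have hC₁0 : 0 < C₁ := by positivity
  set C₂ : ℝ := (E + 1) * B * (1 + A) * 2 ^ S with hC₂
  have hC₂0 : 0 < C₂ := by positivity
  set C₃ : ℝ := 2 * C₁ * 4 ^ S with hC₃
  have hC₃0 : 0 < C₃ := by positivity
  refine ⟨C₁ + C₂ + C₃, by positivity, fun K w H G hK hgrad hgood => ?_⟩
  have hαS : ∀ x, s x - φ x ≤ S := fun x => by linarith [hsS x, hφ x]
  -- One gradient term at a good point `y`: the powers of `r` combine to exponent `s y - φ y`, which
  -- log-Hölder continuity moves to `x`. All the distances used below are at most `4 * r`.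
  have hterm : ∀ (x y : X) (r ρ : ℝ), 0 < r → r ≤ 1 → 0 ≤ ρ → ρ ≤ 4 * r → dist y x < r →
      H y ≤ K * r ^ (-φ y) → ρ ^ s y * H y ≤ B * K * r ^ (s x - φ x) := by
    intro x y r ρ hr hr1 hρ hρr hd hH
    calc ρ ^ s y * H y ≤ ρ ^ s y * (K * r ^ (-φ y)) := by gcongr
      _ ≤ (4 * r) ^ s y * (K * r ^ (-φ y)) := by
        gcongr
        exact (hs y).le
      _ = 4 ^ s y * K * r ^ (s y - φ y) := by
        rw [Real.mul_rpow (by norm_num) hr.le, sub_eq_add_neg, Real.rpow_add hr]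
        ring
      _ ≤ 4 ^ S * K * (A * r ^ (s x - φ x)) := by
        gcongr
        · norm_num
        · exact hsS y
        · exact hA y x r hr hr1 hd.le
      _ = B * K * r ^ (s x - φ x) := by rw [hB]; ring
  -- Starting at radius 1/4 keeps all compared points at distance less than 1, where the gradient
  -- inequality is available.
  set r : ℕ → ℝ := fun j => 1 / 4 * (1 / 2) ^ j with hr
  have hr0 : ∀ j, 0 < r j := fun j => by positivity
  have hr4 : ∀ j, r j ≤ 1 / 4 := fun j => by
    have : ((1 : ℝ) / 2) ^ j ≤ 1 := pow_le_one₀ (by norm_num) (by norm_num)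
    simp only [hr]; linarith
  have hrs : ∀ j, r (j + 1) = r j / 2 := fun j => by simp only [hr, pow_succ]; ring
  choose y hyG hyd hyw hyH using fun x j => hgood x (r j) (hr0 j) ((hr4 j).trans (by norm_num))
  have hrpow : ∀ x j, r j ^ (s x - φ x) =
      (1 / 4) ^ (s x - φ x) * ((1 / 2) ^ (s x - φ x)) ^ j := fun x j => by
    simp only [hr]
    rw [Real.mul_rpow (by norm_num) (by positivity), ← Real.rpow_natCast, ← Real.rpow_natCast,
      ← Real.rpow_mul (by norm_num), ← Real.rpow_mul (by norm_num), mul_comm (j : ℝ)]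
  have hratio : ∀ x, ((1 : ℝ) / 2) ^ (s x - φ x) ≤ θ := fun x =>
    Real.rpow_le_rpow_of_exponent_ge (by norm_num) (by norm_num) (haα x)
  have hstep : ∀ x j, dist (w (y x j)) (w (y x (j + 1))) ≤
      2 * B * K * (1 / 4) ^ (s x - φ x) * ((1 / 2) ^ (s x - φ x)) ^ j := by
    intro x j
    have h1 := hyd x j
    have h2 := hyd x (j + 1)
    have h3 := dist_triangle_right (y x j) (y x (j + 1)) x
    have h4 := hr4 j
    have h5 := hr0 j
    rw [hrs] at h2
    have h6 := hgrad _ (hyG x j) _ (hyG x (j + 1)) (by linarith)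
    have h7 := hterm x _ (r j) (hr0 j) (by linarith) dist_nonneg (by linarith) (hyd x j) (hyH x j)
      (ρ := dist (y x j) (y x (j + 1)))
    have h8 := hterm x _ (r (j + 1)) (hr0 _) (by rw [hrs]; linarith) dist_nonneg
      (by rw [hrs]; linarith) (hyd x (j + 1)) (hyH x (j + 1)) (ρ := dist (y x j) (y x (j + 1)))
    have h9 : r (j + 1) ^ (s x - φ x) ≤ r j ^ (s x - φ x) :=
      Real.rpow_le_rpow (hr0 _).le (by rw [hrs]; linarith) (ha.le.trans (haα x))
    have h10 : B * K * r (j + 1) ^ (s x - φ x) ≤ B * K * r j ^ (s x - φ x) := by gcongr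
    rw [Real.dist_eq, mul_assoc, ← hrpow]
    linarith
  have hlt1 : ∀ x, ((1 : ℝ) / 2) ^ (s x - φ x) < 1 := fun x => (hratio x).trans_lt hθ1
  choose v hv using fun x =>
    cauchySeq_tendsto_of_complete (cauchySeq_of_le_geometric _ _ (hlt1 x) (hstep x))
  have hvdist : ∀ x j, |w (y x j) - v x| ≤ E * B * K * r j ^ (s x - φ x) := by
    intro x j
    refine (dist_le_of_le_geometric_of_tendsto _ _ (hlt1 x) (hstep x) (hv x) j).trans ?_
    rw [mul_assoc (2 * B * K), ← hrpow, hE, mul_div_assoc]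
    have h1 : r j ^ (s x - φ x) / (1 - (1 / 2) ^ (s x - φ x)) ≤
        r j ^ (s x - φ x) * (1 / (1 - θ)) := by
      rw [div_eq_mul_one_div]
      have := hratio x
      have : 0 < 1 - θ := by linarith
      have := hr0 j
      gcongr
    calc _ ≤ _ := mul_le_mul_of_nonneg_left h1 (by positivity)
      _ = _ := by ring
  have hbound : ∀ x, |v x| ≤ C₁ * K := by
    intro x
    have h1 := hvdist x 0
    have h2 := hyw x 0
    have hr00 : r 0 = 1 / 4 := by simp [hr]
    have h3 : r 0 ^ (-φ (y x 0)) ≤ 4 ^ F := by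
      rw [hr00, one_div, Real.inv_rpow (by norm_num), Real.rpow_neg (by norm_num), inv_inv]
      exact Real.rpow_le_rpow_of_exponent_le (by norm_num) (hφF _)
    have h4 : r 0 ^ (s x - φ x) ≤ 1 := Real.rpow_le_one (hr0 0).le
      ((hr4 0).trans (by norm_num)) (ha.le.trans (haα x))
    have h5 : |v x| ≤ |w (y x 0)| + |w (y x 0) - v x| := by
      have := abs_sub (w (y x 0)) (w (y x 0) - v x)
      simpa using this
    have h6 : K * r 0 ^ (-φ (y x 0)) ≤ K * 4 ^ F := by gcongr
    have h7 : E * B * K * r 0 ^ (s x - φ x) ≤ E * B * K * 1 := by gcongr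
    rw [hC₁]
    linarith
  refine ⟨v, fun x hx => ?_, fun x => ?_, fun x x' => ?_⟩
  -- For `x ∈ G` the gradient inequality applies between `x` and its good points; `H x` is a fixed
  -- number, so its term vanishes with the radius.
  · refine tendsto_nhds_unique (hv x) ?_
    have hr_lim : Filter.Tendsto r Filter.atTop (nhds 0) := by
      have := (tendsto_pow_atTop_nhds_zero_of_lt_one (r := (1 / 2 : ℝ)) (by norm_num)
        (by norm_num)).const_mul (1 / 4)
      simpa [hr] using this
    have hlim : Filter.Tendsto (fun j => B * K * r j ^ (s x - φ x) + r j ^ s x * |H x|)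
        Filter.atTop (nhds 0) := by
      have h1 := (hr_lim.rpow_const (p := s x - φ x) (Or.inr (ha.le.trans (haα x)))).const_mul
        (B * K)
      have h2 := (hr_lim.rpow_const (p := s x) (Or.inr (hs x).le)).mul_const |H x|
      have := h1.add h2
      rwa [Real.zero_rpow (ha.trans_le (haα x)).ne', Real.zero_rpow (hs x).ne', mul_zero,
        zero_mul, add_zero] at this
    rw [tendsto_iff_dist_tendsto_zero]
    refine squeeze_zero (fun _ => dist_nonneg) (fun j => ?_) hlim
    have h1 := hyd x j
    have h4 := hr4 j
    have h5 := hr0 j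
    rw [Real.dist_eq]
    refine (hgrad _ (hyG x j) _ hx (by linarith)).trans (add_le_add ?_ ?_)
    · exact hterm x _ (r j) _ h5 (by linarith) dist_nonneg (by linarith) h1 (hyH x j)
    · have h6 : dist (y x j) x ^ s x ≤ r j ^ s x := Real.rpow_le_rpow dist_nonneg h1.le (hs x).le
      exact (mul_le_mul_of_nonneg_left (le_abs_self (H x)) (by positivity)).trans
        (mul_le_mul_of_nonneg_right h6 (abs_nonneg _))
  · refine (hbound x).trans ?_
    gcongr
    linarith
  · have hpos : 0 ≤ dist x x' ^ (s x - φ x) := by positivity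
    rcases eq_or_ne x x' with rfl | hne
    · rw [sub_self, abs_zero]; positivity
    have hd0 : 0 < dist x x' := dist_pos.2 hne
    rcases le_or_gt (dist x x') (1 / 4) with hd | hd
    -- The scale `j` is chosen with `r j` comparable to `dist x x'`; the chains of `x` and `x'` are
    -- joined at that level.
    · obtain ⟨j, hj1, hj2⟩ := exists_nat_pow_near_of_lt_one (x := 4 * dist x x')
        (y := (1 / 2 : ℝ)) (by positivity) (by linarith) (by norm_num) (by norm_num)
      have hdr : dist x x' ≤ r j := by simp only [hr]; linarith
      have hrd : r j ≤ 2 * dist x x' := by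
        rw [pow_succ] at hj1
        simp only [hr]; linarith
      have h5 := hr0 j
      have h4 := hr4 j
      have h1 := hyd x j
      have h2 := hyd x' j
      have htri : dist (y x j) (y x' j) ≤ 3 * r j := by
        have h6 := dist_triangle4_right (y x j) (y x' j) x x'
        linarith
      have hα' : r j ^ (s x' - φ x') ≤ A * r j ^ (s x - φ x) :=
        hA x' x (r j) h5 (by linarith) (by rwa [dist_comm])
      have h7 := hgrad _ (hyG x j) _ (hyG x' j) (by linarith)
      have h8 := hterm x _ (r j) h5 (by linarith) dist_nonneg (by linarith) h1 (hyH x j)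
        (ρ := dist (y x j) (y x' j))
      have h9 := hterm x' _ (r j) h5 (by linarith) dist_nonneg (by linarith) h2 (hyH x' j)
        (ρ := dist (y x j) (y x' j))
      have h10 := hvdist x j
      have h11 := hvdist x' j
      have h12 : |v x - v x'| ≤ |w (y x j) - v x| + |w (y x j) - w (y x' j)|
          + |w (y x' j) - v x'| := by
        rw [show v x - v x' = (w (y x j) - w (y x' j)) - (w (y x j) - v x)
          + (w (y x' j) - v x') by ring]
        have h13 := abs_sub (w (y x j) - w (y x' j)) (w (y x j) - v x)
        have h14 := abs_add_le (w (y x j) - w (y x' j) - (w (y x j) - v x)) (w (y x' j) - v x')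
        linarith
      have h15 : r j ^ (s x - φ x) ≤ 2 ^ S * dist x x' ^ (s x - φ x) := by
        calc r j ^ (s x - φ x) ≤ (2 * dist x x') ^ (s x - φ x) :=
              Real.rpow_le_rpow h5.le hrd (ha.le.trans (haα x))
          _ = 2 ^ (s x - φ x) * dist x x' ^ (s x - φ x) :=
              Real.mul_rpow (by norm_num) hd0.le
          _ ≤ _ := by
              gcongr
              · norm_num
              · exact hαS x
      calc |v x - v x'| ≤ (E + 1) * B * K * (r j ^ (s x - φ x) + r j ^ (s x' - φ x')) := by
            linarith
        _ ≤ (E + 1) * B * K * (r j ^ (s x - φ x) + A * r j ^ (s x - φ x)) := by gcongr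
        _ = (E + 1) * B * K * (1 + A) * r j ^ (s x - φ x) := by ring
        _ ≤ (E + 1) * B * K * (1 + A) * (2 ^ S * dist x x' ^ (s x - φ x)) := by gcongr
        _ = C₂ * K * dist x x' ^ (s x - φ x) := by rw [hC₂]; ring
        _ ≤ _ := by gcongr; linarith
    -- At distances above 1/4 the uniform bound on `v` suffices.
    · have h1 : 1 ≤ 4 ^ S * dist x x' ^ (s x - φ x) := by
        calc (1 : ℝ) ≤ (4 * dist x x') ^ (s x - φ x) :=
              Real.one_le_rpow (by linarith) (ha.le.trans (haα x))
          _ = 4 ^ (s x - φ x) * dist x x' ^ (s x - φ x) := Real.mul_rpow (by norm_num) hd0.le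
          _ ≤ _ := by
              gcongr
              · norm_num
              · exact hαS x
      calc |v x - v x'| ≤ |v x| + |v x'| := abs_sub _ _
        _ ≤ 2 * C₁ * K * 1 := by linarith [hbound x, hbound x']
        _ ≤ 2 * C₁ * K * (4 ^ S * dist x x' ^ (s x - φ x)) := by gcongr
        _ = C₃ * K * dist x x' ^ (s x - φ x) := by rw [hC₃]; ring
        _ ≤ _ := by gcongr; linarith

/-! ### Chebyshev's inequality in balls -/

/-- If `f^p + h^p` were at least `3 / μ(B)` on `B` outside a null set, its integral would be at
least 3, but it is at most 2. Treating the sum yields one point that is good for both functions. -/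
theorem exists_le_of_modular_le_one [MetricSpace X] [MeasurableSpace X] [BorelSpace X]
    {μ : Measure X} (hμ : IsMetricMeasure μ) {Q p : X → ℝ} (hQ : IsBddLogExponent μ Q)
    (hreg : LowerAhlforsRegular μ Q) (hp : IsBddLogExponent μ p) :
    ∃ K : ℝ, 0 < K ∧ ∀ f h : X → ℝ≥0∞, Measurable f → Measurable h →
      modular μ p f ≤ 1 → modular μ p h ≤ 1 → ∀ N : Set X, μ N = 0 → ∀ (x : X) (r : ℝ),
      0 < r → r ≤ 1 → ∃ y, y ∉ N ∧ dist y x < r ∧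
        f y ≤ ENNReal.ofReal (K * r ^ (-(Q y / p y))) ∧
        h y ≤ ENNReal.ofReal (K * r ^ (-(Q y / p y))) := by
  obtain ⟨b, hb, hreg⟩ := hreg
  obtain ⟨A, hA1, hA⟩ := (hQ.logHolder_self hμ).rpow_le
  obtain ⟨c, C, hc, hC, hpb⟩ := hp.exists_bounds hμ
  -- `M ≥ 1` is what allows `M ^ (1 / p y) ≤ M ^ (1 / c)`, making the constant independent of `y`.
  set M : ℝ := max 1 (3 * A / b) with hM
  have hM1 : 1 ≤ M := le_max_left _ _
  refine ⟨M ^ (1 / c), by positivity, fun f h hf hh hf1 hh1 N hN x r hr hr1 => ?_⟩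
  obtain ⟨hB0, hBtop⟩ := hμ x r hr
  set g : X → ℝ≥0∞ := fun y => f y ^ p y + h y ^ p y with hg
  have hgm : Measurable g := (hf.pow hp.measurable).add (hh.pow hp.measurable)
  have hgint : ∫⁻ y, g y ∂μ ≤ 2 := by
    rw [hg, lintegral_add_left (hf.pow hp.measurable), ← one_add_one_eq_two]
    exact add_le_add hf1 hh1
  set ε : ℝ≥0∞ := 3 / μ (Metric.ball x r) with hε
  have hT := mul_meas_ge_le_lintegral (μ := μ) hgm ε
  obtain ⟨y, hyB, hyg, hyN⟩ : ∃ y ∈ Metric.ball x r, g y < ε ∧ y ∉ N := by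
    by_contra! hcon
    have hsub : Metric.ball x r ⊆ {y | ε ≤ g y} ∪ N := fun y hy => by
      rcases le_or_gt ε (g y) with h | h
      · exact Or.inl h
      · exact Or.inr (hcon y hy h)
    have h1 : μ (Metric.ball x r) ≤ μ {y | ε ≤ g y} := by
      refine (measure_mono hsub).trans ((measure_union_le _ _).trans ?_)
      rw [hN, add_zero]
    have h2 : (3 : ℝ≥0∞) ≤ 2 := by
      calc (3 : ℝ≥0∞) = ε * μ (Metric.ball x r) := (ENNReal.div_mul_cancel hB0.ne' hBtop.ne).symm
        _ ≤ ε * μ {y | ε ≤ g y} := by gcongr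
        _ ≤ 2 := hT.trans hgint
    norm_num at h2
  have hpy := hp.pos y
  -- Lower regularity is applied at the centre `x`; log-Hölder continuity then replaces `Q x` by `Q
  -- y`.
  have hεle : ε ≤ ENNReal.ofReal (M * r ^ (-Q y)) := by
    have h1 := hA y x r hr hr1 hyB.le
    have h2 : 0 < r ^ Q x := Real.rpow_pos_of_pos hr _
    have h3 : 0 < r ^ Q y := Real.rpow_pos_of_pos hr _
    calc ε ≤ 3 / ENNReal.ofReal (b * r ^ Q x) := ENNReal.div_le_div_left (hreg x r hr hr1) _
      _ = ENNReal.ofReal (3 / (b * r ^ Q x)) := by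
        rw [ENNReal.ofReal_div_of_pos (by positivity)]
        norm_num
      _ ≤ _ := by
        refine ENNReal.ofReal_le_ofReal ?_
        rw [Real.rpow_neg hr.le, ← div_eq_mul_inv, div_le_div_iff₀ (by positivity) h3]
        calc 3 * r ^ Q y ≤ 3 * (A * r ^ Q x) := by gcongr
          _ = 3 * A / b * (b * r ^ Q x) := by field_simp
          _ ≤ M * (b * r ^ Q x) := by gcongr; exact le_max_right _ _
  have hroot : ∀ t : ℝ≥0∞, t ^ p y ≤ ε → t ≤ ENNReal.ofReal (M ^ (1 / c) * r ^ (-(Q y / p y))) := by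
    intro t ht
    have h1 : t = (t ^ p y) ^ (1 / p y) := by
      rw [← ENNReal.rpow_mul, mul_one_div_cancel hpy.ne', ENNReal.rpow_one]
    rw [h1]
    calc (t ^ p y) ^ (1 / p y) ≤ ENNReal.ofReal (M * r ^ (-Q y)) ^ (1 / p y) := by
          gcongr
          exact ht.trans hεle
      _ = ENNReal.ofReal (M ^ (1 / p y) * r ^ (-(Q y / p y))) := by
          rw [ENNReal.ofReal_rpow_of_pos (by positivity), Real.mul_rpow (by positivity)
            (by positivity), ← Real.rpow_mul hr.le]
          congr 3
          ring
      _ ≤ _ := by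
          gcongr
          exact (hpb y).1
  exact ⟨y, hyN, hyB, hroot _ (le_self_add.trans hyg.le), hroot _ (le_add_self.trans hyg.le)⟩

/-! ### Luxemburg and Hölder norms -/

theorem measurable_ereal_abs : Measurable EReal.abs :=
  EReal.measurable_of_measurable_real (ENNReal.measurable_ofReal.comp measurable_id.abs)

theorem modular_mono [MeasurableSpace X] {μ : Measure X} {p : X → ℝ} (hp : ∀ x, 0 ≤ p x)
    {f g : X → ℝ≥0∞} (h : ∀ x, f x ≤ g x) : modular μ p f ≤ modular μ p g :=
  lintegral_mono fun x => ENNReal.rpow_le_rpow (h x) (hp x)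

theorem modular_div_le_one_of_lpNorm_lt [MeasurableSpace X] {μ : Measure X} {p : X → ℝ}
    (hp : ∀ x, 0 ≤ p x) {f : X → ℝ≥0∞} {L : ℝ≥0∞} (h : lpNorm μ p f < L) :
    modular μ p (fun x => f x / L) ≤ 1 := by
  obtain ⟨l, ⟨-, -, hl⟩, hlL⟩ := sInf_lt_iff.1 h
  exact (modular_mono hp fun x => ENNReal.div_le_div_left hlL.le _).trans hl

/-- With `m ≥ 1` bounding the modular, `l = m^{1/c} ≥ 1` satisfies `l^{p x} ≥ l^c = m`, so dividing
by `l` brings the modular below 1. -/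
theorem lpNorm_lt_top_of_modular_lt_top [MeasurableSpace X] {μ : Measure X} {p : X → ℝ} {c : ℝ}
    (hc : 0 < c) (hp : ∀ x, c ≤ p x) {f : X → ℝ≥0∞} (h : modular μ p f < ∞) :
    lpNorm μ p f < ∞ := by
  set m : ℝ≥0∞ := max 1 (modular μ p f) with hm
  have hm1 : 1 ≤ m := le_max_left _ _
  have hmtop : m < ∞ := max_lt ENNReal.one_lt_top h
  set l : ℝ≥0∞ := m ^ (1 / c) with hl
  have hl1 : 1 ≤ l := ENNReal.one_le_rpow hm1 (by positivity)
  have hltop : l < ∞ := ENNReal.rpow_lt_top_of_nonneg (by positivity) hmtop.ne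
  refine lt_of_le_of_lt (sInf_le ⟨by positivity, hltop, ?_⟩) hltop
  have hlm : l ^ c = m := by
    rw [hl, ← ENNReal.rpow_mul, one_div_mul_cancel hc.ne', ENNReal.rpow_one]
  calc modular μ p (fun x => f x / l) ≤ ∫⁻ x, m⁻¹ * f x ^ p x ∂μ := by
        refine lintegral_mono fun x => ?_
        dsimp only
        rw [ENNReal.div_rpow_of_nonneg _ _ (hc.le.trans (hp x)), mul_comm, div_eq_mul_inv]
        gcongr
        rw [← hlm]
        exact ENNReal.rpow_le_rpow_of_exponent_le hl1 (hp x)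
    _ = m⁻¹ * modular μ p f :=
        lintegral_const_mul' _ _ (ENNReal.inv_ne_top.2 (by positivity))
    _ ≤ m⁻¹ * m := by gcongr; exact le_max_right _ _
    _ ≤ 1 := ENNReal.inv_mul_le_one _

theorem holderNorm_le [MetricSpace X] {α v : X → ℝ} {M : ℝ} (h1 : ∀ x, |v x| ≤ M)
    (h2 : ∀ x y, |v x - v y| ≤ M * dist x y ^ α x) : holderNorm α v ≤ 2 * ENNReal.ofReal M := by
  rw [two_mul]
  refine add_le_add (iSup_le fun x => ENNReal.ofReal_le_ofReal (h1 x))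
    (iSup_le fun x => iSup_le fun y => iSup_le fun hxy => ENNReal.ofReal_le_ofReal ?_)
  have := dist_pos.2 hxy
  rw [div_le_iff₀ (by positivity)]
  exact h2 x y

theorem continuous_of_abs_sub_le_rpow [MetricSpace X] {α v : X → ℝ} {M : ℝ} (hα : ∀ x, 0 < α x)
    (h : ∀ x y, |v x - v y| ≤ M * dist x y ^ α x) : Continuous v := by
  refine continuous_iff_continuousAt.2 fun x => ?_
  rw [ContinuousAt, tendsto_iff_dist_tendsto_zero]
  have h1 : Filter.Tendsto (fun y => dist x y) (nhds x) (nhds 0) := by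
    have : Continuous fun y => dist x y := by fun_prop
    simpa using this.tendsto x
  have h2 := (h1.rpow_const (p := α x) (Or.inr (hα x).le)).const_mul M
  rw [Real.zero_rpow (hα x).ne', mul_zero] at h2
  refine squeeze_zero (fun _ => dist_nonneg) (fun y => ?_) h2
  rw [dist_comm, Real.dist_eq]
  exact h x y

/-! ### From a scalar gradient to the embedding -/

/-- A function with a local scalar Hajłasz gradient in `L^{p(·)}` is Hölder continuous, with
bounds. -/
theorem exists_holder_of_hajlasz [MetricSpace X] [MeasurableSpace X] [BorelSpace X]
    {μ : Measure X} (hμ : IsMetricMeasure μ) {Q p s : X → ℝ} (hQ : IsBddLogExponent μ Q)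
    (hreg : LowerAhlforsRegular μ Q) (hp : IsBddLogExponent μ p) (hs : IsBddLogExponent μ s)
    {a : ℝ} (ha : 0 < a) (haα : ∀ x, a ≤ s x - Q x / p x) :
    ∃ C : ℝ, 0 < C ∧ ∀ (L : ℝ) (u : X → EReal) (h : X → ℝ≥0∞) (N : Set X), 0 < L →
      Measurable u → (∀ᵐ x ∂μ, u x ≠ ⊤ ∧ u x ≠ ⊥) → Measurable h → μ N = 0 →
      modular μ p (fun x => (u x).abs / ENNReal.ofReal L) ≤ 1 →
      modular μ p (fun x => h x / ENNReal.ofReal L) ≤ 1 →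
      (∀ x y, x ∉ N → y ∉ N → 0 < dist x y → dist x y < 1 → (u x - u y).abs ≤
        ENNReal.ofReal (dist x y ^ s x) * h x + ENNReal.ofReal (dist x y ^ s y) * h y) →
      ∃ v : X → ℝ, (∀ᵐ x ∂μ, u x = (v x : EReal)) ∧ (∀ x, |v x| ≤ C * L) ∧
        ∀ x y, |v x - v y| ≤ C * L * dist x y ^ (s x - Q x / p x) := by
  obtain ⟨K, hK, hgood⟩ := exists_le_of_modular_le_one hμ hQ hreg hp
  obtain ⟨cs, S, hcs, hS, hsb⟩ := hs.exists_bounds hμ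
  obtain ⟨C, hC, hcore⟩ := exists_holder_of_good_points (φ := fun x => Q x / p x) ha
    (hQ.logHolder_sub_div hμ hp hs) hs.pos (fun x => (hsb x).2) haα
    (fun x => (div_pos (hQ.pos x) (hp.pos x)).le) (F := S)
    (fun x => by linarith [haα x, (hsb x).2])
  refine ⟨C * K, by positivity, fun L u h N hL hu hufin hh hN hmu hmh hgrad => ?_⟩
  have hL' : ENNReal.ofReal L ≠ 0 := (ENNReal.ofReal_pos.2 hL).ne'
  have hhfin : ∀ᵐ x ∂μ, h x ≠ ∞ := by
    have hm : Measurable fun x => (h x / ENNReal.ofReal L) ^ p x :=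
      (hh.div_const _).pow hp.measurable
    filter_upwards [ae_lt_top hm (hmh.trans_lt ENNReal.one_lt_top).ne] with x hx hxtop
    rw [hxtop, ENNReal.top_div_of_ne_top ENNReal.ofReal_ne_top,
      ENNReal.top_rpow_of_pos (hp.pos x)] at hx
    exact lt_irrefl _ hx
  -- A set of full measure on which the data are real-valued; its complement is the null set that
  -- the good points avoid.
  set G : Set X := {x | x ∉ N ∧ (u x ≠ ⊤ ∧ u x ≠ ⊥) ∧ h x ≠ ∞} with hG
  have hGae : ∀ᵐ x ∂μ, x ∈ G := by
    have hN' : ∀ᵐ x ∂μ, x ∉ N := measure_eq_zero_iff_ae_notMem.1 hN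
    filter_upwards [hN', hufin, hhfin] with x h1 h2 h3 using ⟨h1, h2, h3⟩
  have hcoe : ∀ x ∈ G, ((u x).toReal : EReal) = u x := fun x hx =>
    EReal.coe_toReal hx.2.1.1 hx.2.1.2
  have habs : ∀ x ∈ G, (u x).abs = ENNReal.ofReal |(u x).toReal| := fun x hx => by
    rw [← EReal.abs_def, hcoe x hx]
  have hhx : ∀ x ∈ G, h x = ENNReal.ofReal (h x).toReal := fun x hx =>
    (ENNReal.ofReal_toReal hx.2.2).symm
  have hgradG : ∀ x ∈ G, ∀ y ∈ G, dist x y < 1 → |(u x).toReal - (u y).toReal| ≤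
      dist x y ^ s x * (h x).toReal + dist x y ^ s y * (h y).toReal := by
    intro x hx y hy hd
    rcases eq_or_ne x y with rfl | hne
    · have := (hs.pos x).ne'
      simp [Real.zero_rpow this]
    · have h1 := hgrad x y hx.1 hy.1 (dist_pos.2 hne) hd
      rw [← hcoe x hx, ← hcoe y hy, ← EReal.coe_sub, EReal.abs_def, hhx x hx, hhx y hy,
        ← ENNReal.ofReal_mul (by positivity), ← ENNReal.ofReal_mul (by positivity),
        ← ENNReal.ofReal_add (by positivity) (by positivity)] at h1
      exact (ENNReal.ofReal_le_ofReal_iff (by positivity)).1 h1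
  have hgoodG : ∀ x r, 0 < r → r ≤ 1 → ∃ y ∈ G, dist y x < r ∧
      |(u y).toReal| ≤ K * L * r ^ (-(Q y / p y)) ∧
      (h y).toReal ≤ K * L * r ^ (-(Q y / p y)) := by
    intro x r hr hr1
    obtain ⟨y, hyG, hyd, hy1, hy2⟩ := hgood _ _ ((measurable_ereal_abs.comp hu).div_const _) (hh.div_const _) hmu hmh
      Gᶜ hGae x r hr hr1
    rw [Set.notMem_compl_iff] at hyG
    have hreal : ∀ z : ℝ, ENNReal.ofReal z / ENNReal.ofReal L ≤
        ENNReal.ofReal (K * r ^ (-(Q y / p y))) → z ≤ K * L * r ^ (-(Q y / p y)) := by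
      intro z hz
      rw [← ENNReal.ofReal_div_of_pos hL, ENNReal.ofReal_le_ofReal_iff (by positivity),
        div_le_iff₀ hL] at hz
      linarith
    refine ⟨y, hyG, hyd, hreal _ ?_, hreal _ ?_⟩
    · rwa [← habs y hyG]
    · rwa [← hhx y hyG]
  obtain ⟨v, hv1, hv2, hv3⟩ := hcore (K * L) (fun x => (u x).toReal) (fun x => (h x).toReal) G
    (by positivity) hgradG hgoodG
  refine ⟨v, hGae.mono fun x hx => ?_, fun x => ?_, fun x y => ?_⟩
  · rw [hv1 x hx, hcoe x hx]
  · linarith [hv2 x]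
  · convert hv3 x y using 2
    ring

/-- Embedding into the Hölder space of any class of functions for which the quasi-norm controls
the `L^{p(·)}`-norms of the function and of a local scalar Hajłasz gradient. -/
theorem embedsInHolder_of_hajlasz [MetricSpace X] [MeasurableSpace X] [BorelSpace X]
    {μ : Measure X} (hμ : IsMetricMeasure μ) {Q p s : X → ℝ} (hQ : IsBddLogExponent μ Q)
    (hreg : LowerAhlforsRegular μ Q) (hp : IsBddLogExponent μ p) (hs : IsBddLogExponent μ s)
    (hsp : MuchLess μ Q (fun x => s x * p x)) {V : Set (X → EReal)} {n : (X → EReal) → ℝ≥0∞}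
    (hV : ∀ u ∈ V, Measurable u ∧ (∀ᵐ x ∂μ, u x ≠ ⊤ ∧ u x ≠ ⊥) ∧ n u < ∞)
    (hn : ∀ u ∈ V, lpNorm μ p (fun x => (u x).abs) ≤ n u) {D : ℝ} (hD : 1 ≤ D)
    (hgrad : ∀ u ∈ V, ∀ L : ℝ, 0 < L → n u < ENNReal.ofReal L →
      ∃ (h : X → ℝ≥0∞) (N : Set X), Measurable h ∧ μ N = 0 ∧
        modular μ p (fun x => h x / ENNReal.ofReal (D * L)) ≤ 1 ∧
        ∀ x y, x ∉ N → y ∉ N → 0 < dist x y → dist x y < 1 → (u x - u y).abs ≤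
          ENNReal.ofReal (dist x y ^ s x) * h x + ENNReal.ofReal (dist x y ^ s y) * h y) :
    EmbedsInHolder μ V n (fun x => s x - Q x / p x) := by
  obtain ⟨c, hc, hc'⟩ := hsp.exists_forall_le hμ hQ.continuous (hs.continuous.mul hp.continuous)
  obtain ⟨cp, P, hcp, hP, hpb⟩ := hp.exists_bounds hμ
  obtain ⟨cs, S, hcs, hS, hsb⟩ := hs.exists_bounds hμ
  have ha : 0 < c / P := by positivity
  have haα : ∀ x, c / P ≤ s x - Q x / p x := fun x => by
    have hpx := hp.pos x
    have h1 : c / P ≤ c / p x := by gcongr; exact (hpb x).2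
    have h2 : c / p x ≤ (s x * p x - Q x) / p x := by gcongr; exact hc' x
    rw [sub_div, mul_div_cancel_right₀ _ hpx.ne'] at h2
    linarith
  refine ⟨fun x => ha.le.trans (haα x), ⟨S, ?_⟩, ?_⟩
  · rintro _ ⟨x, rfl⟩
    have := div_pos (hQ.pos x) (hp.pos x)
    dsimp only
    linarith [(hsb x).2]
  obtain ⟨C, hC, hmain⟩ := exists_holder_of_hajlasz hμ hQ hreg hp hs ha haα
  have hrep : ∀ u ∈ V, ∀ L : ℝ, 0 < L → n u < ENNReal.ofReal L →
      ∃ v : X → ℝ, (∀ᵐ x ∂μ, u x = (v x : EReal)) ∧ (∀ x, |v x| ≤ C * (D * L)) ∧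
        ∀ x y, |v x - v y| ≤ C * (D * L) * dist x y ^ (s x - Q x / p x) := by
    intro u hu L hL hnL
    obtain ⟨h, N, hh, hN, hm, hg⟩ := hgrad u hu L hL hnL
    refine hmain (D * L) u h N (by positivity) (hV u hu).1 (hV u hu).2.1 hh hN ?_ hm hg
    refine modular_div_le_one_of_lpNorm_lt (fun x => (hp.pos x).le) ((hn u hu).trans_lt ?_)
    refine hnL.trans_le (ENNReal.ofReal_le_ofReal ?_)
    nlinarith
  refine ⟨(4 * C * D).toNNReal, fun u hu => ?_⟩
  -- When the quasi-norm vanishes, every `L = 1/(k+1)` is admissible, which forces `u = 0` almost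
  -- everywhere. Otherwise `L = 2 n(u)` lies strictly above the quasi-norm; this 2 and the one in
  -- `holderNorm_le` make up the 4 in the constant.
  rcases eq_or_ne (n u) 0 with h0 | h0
  · refine ⟨fun _ => 0, ⟨continuous_const, ?_⟩, ?_, ?_⟩
    · simp [holderNorm]
    · have hall : ∀ᵐ x ∂μ, ∀ k : ℕ, ∃ t : ℝ, u x = (t : EReal) ∧ |t| ≤ C * D * (1 / (k + 1)) := by
        refine ae_all_iff.2 fun k => ?_
        have hk : (0 : ℝ) < 1 / ((k : ℝ) + 1) := by positivity
        obtain ⟨v, hv1, hv2, -⟩ := hrep u hu (1 / (k + 1)) hk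
          (by rw [h0]; exact ENNReal.ofReal_pos.2 hk)
        exact hv1.mono fun x hx => ⟨v x, hx, by linarith [hv2 x]⟩
      filter_upwards [hall] with x hx
      obtain ⟨t, ht, -⟩ := hx 0
      have h1 : ∀ k : ℕ, |t| ≤ C * D * (1 / (k + 1)) := fun k => by
        obtain ⟨t', ht', hle⟩ := hx k
        rw [ht, EReal.coe_eq_coe_iff] at ht'
        rwa [ht']
      have h2 : |t| ≤ C * D * 0 :=
        ge_of_tendsto' (tendsto_one_div_add_atTop_nhds_zero_nat.const_mul (C * D)) h1
      rw [mul_zero, abs_nonpos_iff] at h2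
      rw [ht, h2]
    · simp [holderNorm]
  · have htop := (hV u hu).2.2
    have hpos : 0 < (n u).toReal := ENNReal.toReal_pos h0 htop.ne
    obtain ⟨v, hv1, hv2, hv3⟩ := hrep u hu (2 * (n u).toReal) (by positivity) (by
      rw [← ENNReal.toReal_lt_toReal htop.ne ENNReal.ofReal_ne_top,
        ENNReal.toReal_ofReal (by positivity)]
      linarith)
    have hle : holderNorm (fun x => s x - Q x / p x) v ≤ ((4 * C * D).toNNReal : ℝ≥0) * n u := by
      refine (holderNorm_le hv2 hv3).trans (le_of_eq ?_)
      conv_rhs => rw [← ENNReal.ofReal_toReal htop.ne]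
      rw [← ENNReal.ofReal.eq_1, ← ENNReal.ofReal_mul (by positivity),
        show (2 : ℝ≥0∞) = ENNReal.ofReal 2 by norm_num, ← ENNReal.ofReal_mul (by norm_num)]
      congr 1
      ring
    refine ⟨v, ⟨continuous_of_abs_sub_le_rpow (fun x => ha.trans_le (haα x)) hv3, ?_⟩, hv1, hle⟩
    exact hle.trans_lt (ENNReal.mul_lt_top ENNReal.coe_lt_top htop)

/-! ### Suprema and modulars of sequences -/

theorem le_seqNorm {q : ℝ≥0∞} (hq : 0 < q) (a : ℤ → ℝ≥0∞) (k : ℤ) : a k ≤ seqNorm q a := by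
  rw [seqNorm]
  split_ifs with h
  · exact le_iSup a k
  · have hq' : 0 < q.toReal := ENNReal.toReal_pos hq.ne' h
    calc a k = (a k ^ q.toReal) ^ (1 / q.toReal) := by
          rw [← ENNReal.rpow_mul, mul_one_div_cancel hq'.ne', ENNReal.rpow_one]
      _ ≤ _ := ENNReal.rpow_le_rpow (ENNReal.le_tsum k) (by positivity)

/-- Pointwise, the supremum is dominated by the `ℓ^{p x}` quasi-norm. -/
theorem modular_iSup_le {ι : Type*} [Countable ι] [MeasurableSpace X] {μ : Measure X} {p : X → ℝ}
    (hpm : Measurable p) (hp : ∀ x, 0 < p x) {f : ι → X → ℝ≥0∞} (hf : ∀ i, Measurable (f i)) :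
    modular μ p (fun x => ⨆ i, f i x) ≤ ∑' i, modular μ p (f i) := by
  simp only [modular]
  rw [← lintegral_tsum fun i => ((hf i).pow hpm).aemeasurable]
  refine lintegral_mono fun x => ?_
  have hpx := hp x
  have h : ⨆ i, f i x ≤ (∑' i, f i x ^ p x) ^ (1 / p x) := iSup_le fun i => by
    calc f i x = (f i x ^ p x) ^ (1 / p x) := by
          rw [← ENNReal.rpow_mul, mul_one_div_cancel hpx.ne', ENNReal.rpow_one]
      _ ≤ _ := ENNReal.rpow_le_rpow (ENNReal.le_tsum i) (by positivity)
  calc (⨆ i, f i x) ^ p x ≤ ((∑' i, f i x ^ p x) ^ (1 / p x)) ^ p x :=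
        ENNReal.rpow_le_rpow h hpx.le
    _ = ∑' i, f i x ^ p x := by
        rw [← ENNReal.rpow_mul, one_div_mul_cancel hpx.ne', ENNReal.rpow_one]

/-- The infima defining the modular need not be attained. Near-minimizers with summable errors of
total below 1 raise the bound from 1 to 2. -/
theorem exists_scales_of_seqLpNorm_lt [MeasurableSpace X] {μ : Measure X} {p : X → ℝ}
    (hp : ∀ x, 0 ≤ p x) {q : X → ℝ≥0∞} {g : ℤ → X → ℝ≥0∞} {L : ℝ≥0∞}
    (h : seqLpNorm μ p q g < L) :
    ∃ l : ℤ → ℝ≥0∞, (∀ k, 0 < l k) ∧ ∑' k, l k ≤ 2 ∧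
      ∀ k, modular μ p (fun x => g k x / L / l k ^ ((q x)⁻¹).toReal) ≤ 1 := by
  obtain ⟨m, ⟨-, -, hm⟩, hmL⟩ := sInf_lt_iff.1 h
  obtain ⟨ε, hε, hεsum⟩ := ENNReal.exists_pos_sum_of_countable' one_ne_zero ℤ
  have hex : ∀ k, ∃ l : ℝ≥0∞, 0 < l ∧
      l ≤ sInf {l : ℝ≥0∞ | 0 < l ∧ l < ∞ ∧
        modular μ p (fun x => g k x / m / l ^ ((q x)⁻¹).toReal) ≤ 1} + ε k ∧
      modular μ p (fun x => g k x / m / l ^ ((q x)⁻¹).toReal) ≤ 1 := fun k => by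
    have hfin : sInf {l : ℝ≥0∞ | 0 < l ∧ l < ∞ ∧
        modular μ p (fun x => g k x / m / l ^ ((q x)⁻¹).toReal) ≤ 1} ≠ ∞ :=
      (((ENNReal.le_tsum k).trans hm).trans_lt ENNReal.one_lt_top).ne
    obtain ⟨l, ⟨h1, -, h2⟩, h3⟩ := sInf_lt_iff.1 (ENNReal.lt_add_right hfin (hε k).ne')
    exact ⟨l, h1, h3.le, h2⟩
  choose l hl0 hl1 hl2 using hex
  refine ⟨l, hl0, ?_, fun k => (modular_mono hp fun x => ?_).trans (hl2 k)⟩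
  · refine (ENNReal.tsum_le_tsum hl1).trans ?_
    rw [ENNReal.tsum_add, ← one_add_one_eq_two]
    exact add_le_add hm hεsum.le
  · exact ENNReal.div_le_div_right (ENNReal.div_le_div_left hmL.le _) _

/-- Dividing by `2^κ ≥ 2^e` replaces the scale `l` by `l / 2`, which is at most 1 in the
applications with `e = 1/q`. Then `M = 1` is always allowed, and `M = l / 2` when `e * p ≥ 1`. -/
theorem modular_div_le_of_scale [MeasurableSpace X] {μ : Measure X} {p e : X → ℝ} {κ : ℝ}
    {l M : ℝ≥0∞} {f : X → ℝ≥0∞} (hp : ∀ x, 0 ≤ p x) (he : ∀ x, 0 ≤ e x) (heκ : ∀ᵐ x ∂μ, e x ≤ κ)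
    (hl : 0 < l) (hl' : l ≠ ∞) (hM : M ≠ ∞) (hlM : ∀ x, (l / 2) ^ (e x * p x) ≤ M)
    (h : modular μ p (fun x => f x / l ^ e x) ≤ 1) :
    modular μ p (fun x => f x / ENNReal.ofReal (2 ^ κ)) ≤ M := by
  calc modular μ p (fun x => f x / ENNReal.ofReal (2 ^ κ))
      ≤ ∫⁻ x, M * (f x / l ^ e x) ^ p x ∂μ := by
        refine lintegral_mono_ae (heκ.mono fun x hx => ?_)
        have hle0 : l ^ e x ≠ 0 := (ENNReal.rpow_pos hl hl').ne'
        have hle1 : l ^ e x ≠ ∞ := ENNReal.rpow_ne_top_of_nonneg (he x) hl'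
        have h1 : f x / ENNReal.ofReal (2 ^ κ) ≤ (l / 2) ^ e x * (f x / l ^ e x) := by
          rw [ENNReal.div_rpow_of_nonneg _ _ (he x), ← ENNReal.ofReal_rpow_of_pos two_pos]
          calc f x / ENNReal.ofReal 2 ^ κ ≤ f x / 2 ^ e x := by
                refine ENNReal.div_le_div_left ?_ _
                rw [show ENNReal.ofReal 2 = 2 by norm_num]
                exact ENNReal.rpow_le_rpow_of_exponent_le one_le_two hx
            _ = l ^ e x * (l ^ e x)⁻¹ * (f x / 2 ^ e x) := by
                rw [ENNReal.mul_inv_cancel hle0 hle1, one_mul]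
            _ = _ := by simp only [div_eq_mul_inv]; ring
        calc (f x / ENNReal.ofReal (2 ^ κ)) ^ p x
            ≤ ((l / 2) ^ e x * (f x / l ^ e x)) ^ p x := ENNReal.rpow_le_rpow h1 (hp x)
          _ = (l / 2) ^ (e x * p x) * (f x / l ^ e x) ^ p x := by
              rw [ENNReal.mul_rpow_of_nonneg _ _ (hp x), ENNReal.rpow_mul]
          _ ≤ _ := by gcongr; exact hlM x
    _ = M * modular μ p (fun x => f x / l ^ e x) := lintegral_const_mul' _ _ hM
    _ ≤ M * 1 := by gcongr
    _ = M := mul_one M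

/-- That `k` is nonnegative matters: the weights `τ^k` decay only in that direction. -/
theorem exists_dyadic_scale {d : ℝ} (hd : 0 < d) (hd1 : d < 1) :
    ∃ k : ℕ, (2 : ℝ) ^ (-(k : ℤ) - 1) ≤ d ∧ d < (2 : ℝ) ^ (-(k : ℤ)) := by
  obtain ⟨n, hn1, hn2⟩ := exists_mem_Ico_zpow hd one_lt_two
  have hn : n < 0 := by
    by_contra! hcon
    linarith [one_le_zpow₀ (one_le_two (α := ℝ)) hcon]
  obtain ⟨k, hk⟩ := Int.eq_ofNat_of_zero_le (show 0 ≤ -n - 1 by omega)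
  refine ⟨k, ?_, ?_⟩
  · rwa [← hk, show -(-n - 1) - 1 = n by ring]
  · rwa [← hk, show -(-n - 1) = n + 1 by ring]

theorem div_ofReal_mul {D : ℝ} (hD : 0 < D) (L : ℝ) (x : ℝ≥0∞) :
    x / ENNReal.ofReal (D * L) = x / ENNReal.ofReal L / ENNReal.ofReal D := by
  rw [ENNReal.ofReal_mul hD.le, div_eq_mul_inv, div_eq_mul_inv, div_eq_mul_inv,
    ENNReal.mul_inv (Or.inl (ENNReal.ofReal_pos.2 hD).ne') (Or.inl ENNReal.ofReal_ne_top)]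
  ring

theorem IsExponent.exists_inv_le [MeasurableSpace X] {μ : Measure X} {q : X → ℝ≥0∞}
    (hq : IsExponent μ q) : ∃ κ : ℝ, 0 ≤ κ ∧ ∀ᵐ x ∂μ, ((q x)⁻¹).toReal ≤ κ := by
  obtain ⟨c, hc, h⟩ := hq.essInf_pos
  exact ⟨(c⁻¹).toReal, ENNReal.toReal_nonneg, h.mono fun x hx =>
    ENNReal.toReal_mono (ENNReal.inv_ne_top.2 hc.ne') (ENNReal.inv_le_inv.2 hx)⟩

theorem vectorGradients.exists_iSup_bound [MetricSpace X] [MeasurableSpace X] {μ : Measure X}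
    {s : X → ℝ} {u : X → EReal} {g : ℤ → X → ℝ≥0∞} (hg : g ∈ vectorGradients μ s u) :
    ∃ N : Set X, μ N = 0 ∧ ∀ x y, x ∉ N → y ∉ N → 0 < dist x y → dist x y < 1 →
      (u x - u y).abs ≤ ENNReal.ofReal (dist x y ^ s x) * (⨆ k, g k x) +
        ENNReal.ofReal (dist x y ^ s y) * ⨆ k, g k y := by
  obtain ⟨-, N, hN, h⟩ := hg
  refine ⟨N, hN, fun x y hx hy hd hd1 => ?_⟩
  obtain ⟨k, hk1, hk2⟩ := exists_dyadic_scale hd hd1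
  refine (h k x y hx hy hk1 hk2).trans ?_
  gcongr
  · exact le_iSup (fun k => g k x) _
  · exact le_iSup (fun k => g k y) _

/-! ### The three embeddings -/

theorem triebelLizorkin_embedsInHolder [MetricSpace X] [MeasurableSpace X] [BorelSpace X]
    {μ : Measure X} (hμ : IsMetricMeasure μ) {Q p s : X → ℝ} (hQ : IsBddLogExponent μ Q)
    (hreg : LowerAhlforsRegular μ Q) (hp : IsBddLogExponent μ p) (hs : IsBddLogExponent μ s)
    (hsp : MuchLess μ Q (fun x => s x * p x)) {q : X → ℝ≥0∞} (hq : IsExponent μ q) :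
    EmbedsInHolder μ (TriebelLizorkin μ s p q) (triebelLizorkinNorm μ s p q)
      (fun x => s x - Q x / p x) := by
  obtain ⟨c, P, hc, hP, hpb⟩ := hp.exists_bounds hμ
  refine embedsInHolder_of_hajlasz hμ hQ hreg hp hs hsp (D := 1) (fun u hu => ⟨hu.1.1, hu.1.2.1,
    ENNReal.add_lt_top.2 ⟨lpNorm_lt_top_of_modular_lt_top hc (fun x => (hpb x).1) hu.2.2,
      hu.1.2.2⟩⟩) (fun u _ => le_self_add) le_rfl fun u hu L hL hn => ?_
  obtain ⟨g, hg⟩ := iInf_lt_iff.1 (lt_of_le_of_lt le_add_self hn)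
  obtain ⟨hgD, hgL⟩ := iInf_lt_iff.1 hg
  obtain ⟨N, hN, hgrad⟩ := vectorGradients.exists_iSup_bound hgD
  refine ⟨fun x => ⨆ k, g k x, N, Measurable.iSup hgD.1, hN, ?_, hgrad⟩
  rw [one_mul]
  refine (modular_mono (fun x => (hp.pos x).le) fun x => ?_).trans
    (modular_div_le_one_of_lpNorm_lt (fun x => (hp.pos x).le) hgL)
  exact ENNReal.div_le_div_right (iSup_le fun k => le_seqNorm (hq.pos x) (fun k => g k x) k) _

theorem besov_embedsInHolder_of_le [MetricSpace X] [MeasurableSpace X] [BorelSpace X]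
    {μ : Measure X} (hμ : IsMetricMeasure μ) {Q p s : X → ℝ} (hQ : IsBddLogExponent μ Q)
    (hreg : LowerAhlforsRegular μ Q) (hp : IsBddLogExponent μ p) (hs : IsBddLogExponent μ s)
    (hsp : MuchLess μ Q (fun x => s x * p x)) {q : X → ℝ≥0∞} (hq : IsExponent μ q)
    (hqp : ∀ x, q x ≤ ENNReal.ofReal (p x)) :
    EmbedsInHolder μ (Besov μ s p q) (besovNorm μ s p q) (fun x => s x - Q x / p x) := by
  obtain ⟨c, P, hc, hP, hpb⟩ := hp.exists_bounds hμ
  obtain ⟨κ, hκ, hqκ⟩ := hq.exists_inv_le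
  have hp0 : ∀ x, 0 ≤ p x := fun x => (hp.pos x).le
  refine embedsInHolder_of_hajlasz hμ hQ hreg hp hs hsp (D := 2 ^ κ) (fun u hu => ⟨hu.1.1,
    hu.1.2.1, ENNReal.add_lt_top.2 ⟨lpNorm_lt_top_of_modular_lt_top hc (fun x => (hpb x).1) hu.2.2,
      hu.1.2.2⟩⟩) (fun u _ => le_self_add) (Real.one_le_rpow one_le_two hκ)
      fun u hu L hL hn => ?_
  obtain ⟨g, hg⟩ := iInf_lt_iff.1 (lt_of_le_of_lt le_add_self hn)
  obtain ⟨hgD, hgL⟩ := iInf_lt_iff.1 hg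
  obtain ⟨N, hN, hgrad⟩ := vectorGradients.exists_iSup_bound hgD
  obtain ⟨l, hl0, hlsum, hl⟩ := exists_scales_of_seqLpNorm_lt hp0 hgL
  refine ⟨fun x => ⨆ k, g k x, N, Measurable.iSup hgD.1, hN, ?_, hgrad⟩
  simp only [div_ofReal_mul (show (0 : ℝ) < 2 ^ κ by positivity) L, ENNReal.iSup_div]
  refine (modular_iSup_le hp.measurable hp.pos fun k =>
    ((hgD.1 k).div_const _).div_const _).trans ?_
  have hl2 : ∀ k, l k ≤ 2 := fun k => (ENNReal.le_tsum k).trans hlsum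
  have hterm : ∀ k, modular μ p (fun x => g k x / ENNReal.ofReal L / ENNReal.ofReal (2 ^ κ)) ≤
      l k / 2 := fun k => by
    have hltop : l k ≠ ∞ := ((hl2 k).trans_lt (by norm_num)).ne
    have hl1 : l k / 2 ≤ 1 := ENNReal.div_le_of_le_mul (by simpa using hl2 k)
    refine modular_div_le_of_scale hp0 (fun _ => ENNReal.toReal_nonneg) hqκ (hl0 k) hltop
      (hl1.trans_lt ENNReal.one_lt_top).ne (fun x => ?_) (hl k)
    have hpx := hp.pos x
    have h1 : (p x)⁻¹ ≤ ((q x)⁻¹).toReal := by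
      rw [← ENNReal.toReal_ofReal (inv_nonneg.2 hpx.le), ENNReal.ofReal_inv_of_pos hpx]
      exact ENNReal.toReal_mono (ENNReal.inv_ne_top.2 (hq.pos x).ne')
        (ENNReal.inv_le_inv.2 (hqp x))
    -- This is where `q ≤ p` enters: `(l k / 2)^{p/q} ≤ l k / 2`, and these bounds sum to at most 1.
    have h2 : 1 ≤ ((q x)⁻¹).toReal * p x := by
      rw [← inv_mul_cancel₀ hpx.ne']
      gcongr
    simpa using ENNReal.rpow_le_rpow_of_exponent_ge hl1 h2
  refine (ENNReal.tsum_le_tsum hterm).trans ?_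
  simp only [div_eq_mul_inv]
  rw [ENNReal.tsum_mul_right, ← div_eq_mul_inv]
  exact ENNReal.div_le_of_le_mul (by simpa using hlsum)

/-- At distance `d < 2^{-k}` one has `d^s ≤ d^t d^δ ≤ d^t τ^k` with `τ = 2^{-δ}`. The weights `τ^k`
make the modulars summable even though each unweighted one is only bounded by 1, so `q` need not be
compared with `p`. -/
theorem besov_embedsInHolder_of_muchLess [MetricSpace X] [MeasurableSpace X] [BorelSpace X]
    {μ : Measure X} (hμ : IsMetricMeasure μ) {Q p s t : X → ℝ} (hQ : IsBddLogExponent μ Q)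
    (hreg : LowerAhlforsRegular μ Q) (hp : IsBddLogExponent μ p) (hs : IsBddLogExponent μ s)
    (ht : IsBddLogExponent μ t) {q : X → ℝ≥0∞} (hq : IsExponent μ q)
    (htp : MuchLess μ Q (fun x => t x * p x))
    (htsp : MuchLess μ (fun x => t x * p x) (fun x => s x * p x)) :
    EmbedsInHolder μ (Besov μ s p q) (besovNorm μ s p q) (fun x => t x - Q x / p x) := by
  obtain ⟨c, P, hc, hP, hpb⟩ := hp.exists_bounds hμ
  obtain ⟨κ, hκ, hqκ⟩ := hq.exists_inv_le
  have hp0 : ∀ x, 0 ≤ p x := fun x => (hp.pos x).le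
  obtain ⟨η, hη, hη'⟩ := htsp.exists_forall_le hμ (ht.continuous.mul hp.continuous)
    (hs.continuous.mul hp.continuous)
  set δ : ℝ := η / P with hδ
  have hδ0 : 0 < δ := by positivity
  have hst : ∀ x, δ ≤ s x - t x := fun x => by
    have hpx := hp.pos x
    rw [hδ, div_le_iff₀ hP]
    have h1 : η ≤ s x * p x - t x * p x := hη' x
    rw [← sub_mul] at h1
    have h2 : 0 < s x - t x := pos_of_mul_pos_left (hη.trans_le h1) hpx.le
    exact h1.trans (mul_le_mul_of_nonneg_left (hpb x).2 h2.le)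
  set τ : ℝ := (1 / 2) ^ δ with hτ
  have hτ0 : 0 < τ := by positivity
  have hτ1 : τ < 1 := Real.rpow_lt_one (by norm_num) (by norm_num) hδ0
  set θ : ℝ := τ ^ c with hθ
  have hθ0 : 0 < θ := by positivity
  have hθ1 : θ < 1 := Real.rpow_lt_one hτ0.le hτ1 hc
  have hθ' : 0 < 1 - θ := by linarith
  -- The weight `τ^k` contributes at most `θ^k` to the modular, since `p ≥ c`. Dividing by `E`,
  -- where `E^c = (1 - θ)⁻¹`, normalises the geometric sum to exactly 1.
  set E : ℝ := (1 - θ)⁻¹ ^ c⁻¹ with hE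
  have hE1 : 1 ≤ E := Real.one_le_rpow ((one_le_inv₀ hθ').2 (by linarith)) (by positivity)
  have hE0 : 0 < E := by linarith
  have hEc : E ^ c = (1 - θ)⁻¹ := by
    rw [hE, ← Real.rpow_mul (by positivity), inv_mul_cancel₀ hc.ne', Real.rpow_one]
  have h2κ : (1 : ℝ) ≤ 2 ^ κ := Real.one_le_rpow one_le_two hκ
  refine embedsInHolder_of_hajlasz hμ hQ hreg hp ht htp (D := E * 2 ^ κ) (fun u hu => ⟨hu.1.1,
    hu.1.2.1, ENNReal.add_lt_top.2 ⟨lpNorm_lt_top_of_modular_lt_top hc (fun x => (hpb x).1) hu.2.2,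
      hu.1.2.2⟩⟩) (fun u _ => le_self_add) (one_le_mul_of_one_le_of_one_le hE1 h2κ)
      fun u hu L hL hn => ?_
  obtain ⟨g, hg⟩ := iInf_lt_iff.1 (lt_of_le_of_lt le_add_self hn)
  obtain ⟨hgD, hgL⟩ := iInf_lt_iff.1 hg
  obtain ⟨l, hl0, hlsum, hl⟩ := exists_scales_of_seqLpNorm_lt hp0 hgL
  have hl2 : ∀ k, l k ≤ 2 := fun k => (ENNReal.le_tsum k).trans hlsum
  obtain ⟨hgm, N, hN, hgrad⟩ := hgD
  refine ⟨fun x => ⨆ k : ℕ, ENNReal.ofReal (τ ^ k) * g k x, N,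
    Measurable.iSup fun k => (hgm k).const_mul _, hN, ?_, fun x y hx hy hd hd1 => ?_⟩
  · have hmod : ∀ k, modular μ p
        (fun x => g k x / ENNReal.ofReal L / ENNReal.ofReal (2 ^ κ)) ≤ 1 := fun k => by
      have hltop : l k ≠ ∞ := ((hl2 k).trans_lt (by norm_num)).ne
      have hl1 : l k / 2 ≤ 1 := ENNReal.div_le_of_le_mul (by simpa using hl2 k)
      refine modular_div_le_of_scale hp0 (fun _ => ENNReal.toReal_nonneg) hqκ (hl0 k) hltop
        ENNReal.one_ne_top (fun x => ?_) (hl k)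
      exact ENNReal.rpow_le_one hl1 (mul_nonneg ENNReal.toReal_nonneg (hp0 x))
    simp only [ENNReal.iSup_div]
    refine (modular_iSup_le hp.measurable hp.pos fun k : ℕ =>
      ((hgm (k : ℤ)).const_mul (ENNReal.ofReal (τ ^ k))).div_const _).trans ?_
    have hterm : ∀ k : ℕ, modular μ p
        (fun x => ENNReal.ofReal (τ ^ k) * g k x / ENNReal.ofReal (E * 2 ^ κ * L)) ≤
        ENNReal.ofReal (θ ^ k * (1 - θ)) := fun k => by
      -- A base at most 1 lets the exponent `p x` be lowered to `c`.
      have ht1 : τ ^ k / E ≤ 1 :=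
        (div_le_one hE0).2 ((pow_le_one₀ hτ0.le hτ1.le).trans hE1)
      have htc : (τ ^ k / E) ^ c = θ ^ k * (1 - θ) := by
        rw [Real.div_rpow (by positivity) hE0.le, hEc, div_inv_eq_mul, hθ, ← Real.rpow_natCast,
          ← Real.rpow_natCast, ← Real.rpow_mul hτ0.le, ← Real.rpow_mul hτ0.le, mul_comm c]
      calc modular μ p
            (fun x => ENNReal.ofReal (τ ^ k) * g k x / ENNReal.ofReal (E * 2 ^ κ * L))
          ≤ ∫⁻ x, ENNReal.ofReal (θ ^ k * (1 - θ)) *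
            (g k x / ENNReal.ofReal L / ENNReal.ofReal (2 ^ κ)) ^ p x ∂μ := by
            refine lintegral_mono fun x => ?_
            have h1 : ENNReal.ofReal (τ ^ k) * g k x / ENNReal.ofReal (E * 2 ^ κ * L) =
                ENNReal.ofReal (τ ^ k / E) *
                  (g k x / ENNReal.ofReal L / ENNReal.ofReal (2 ^ κ)) := by
              rw [mul_assoc E, div_ofReal_mul hE0,
                div_ofReal_mul (by positivity) L, ENNReal.ofReal_div_of_pos hE0]
              simp only [div_eq_mul_inv]
              ring
            dsimp only
            rw [h1, ENNReal.mul_rpow_of_nonneg _ _ (hp0 x),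
              ENNReal.ofReal_rpow_of_pos (by positivity), ← htc]
            gcongr ENNReal.ofReal ?_ * _
            exact Real.rpow_le_rpow_of_exponent_ge (by positivity) ht1 (hpb x).1
        _ = ENNReal.ofReal (θ ^ k * (1 - θ)) * modular μ p
            (fun x => g k x / ENNReal.ofReal L / ENNReal.ofReal (2 ^ κ)) :=
            lintegral_const_mul' _ _ ENNReal.ofReal_ne_top
        _ ≤ ENNReal.ofReal (θ ^ k * (1 - θ)) * 1 := by gcongr; exact hmod k
        _ = _ := mul_one _
    refine (ENNReal.tsum_le_tsum hterm).trans (le_of_eq ?_)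
    have hsum := (hasSum_geometric_of_lt_one hθ0.le hθ1).mul_right (1 - θ)
    rw [inv_mul_cancel₀ hθ'.ne'] at hsum
    rw [← ENNReal.ofReal_tsum_of_nonneg (fun k => by positivity) hsum.summable, hsum.tsum_eq,
      ENNReal.ofReal_one]
  · obtain ⟨k, hk1, hk2⟩ := exists_dyadic_scale hd hd1
    have hτk : dist x y ^ δ ≤ τ ^ k := by
      calc dist x y ^ δ ≤ ((2 : ℝ) ^ (-(k : ℤ))) ^ δ := by gcongr
        _ = τ ^ k := by
          rw [hτ, zpow_neg, zpow_natCast, ← inv_pow, ← one_div, ← Real.rpow_natCast,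
            ← Real.rpow_natCast, ← Real.rpow_mul (by norm_num), ← Real.rpow_mul (by norm_num),
            mul_comm δ]
    have hle : ∀ z, ENNReal.ofReal (dist x y ^ s z) * g k z ≤
        ENNReal.ofReal (dist x y ^ t z) * ⨆ k : ℕ, ENNReal.ofReal (τ ^ k) * g k z := fun z => by
      calc ENNReal.ofReal (dist x y ^ s z) * g k z
          ≤ ENNReal.ofReal (dist x y ^ t z * τ ^ k) * g k z := by
            gcongr
            calc dist x y ^ s z = dist x y ^ t z * dist x y ^ (s z - t z) := by
                  rw [← Real.rpow_add hd]; congr 1; ring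
              _ ≤ dist x y ^ t z * dist x y ^ δ := by
                  gcongr ?_ * ?_
                  exact Real.rpow_le_rpow_of_exponent_ge hd hd1.le (hst z)
              _ ≤ _ := by gcongr
        _ = ENNReal.ofReal (dist x y ^ t z) * (ENNReal.ofReal (τ ^ k) * g k z) := by
            rw [ENNReal.ofReal_mul (by positivity), mul_assoc]
        _ ≤ _ := by
            gcongr
            exact le_iSup (fun k : ℕ => ENNReal.ofReal (τ ^ k) * g k z) k
    exact (hgrad k x y hx hy hk1 hk2).trans (add_le_add (hle x) (hle y))

end VarExp

theorem mainTheorem8 {X : Type*} [MetricSpace X] [MeasurableSpace X] [BorelSpace X]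
    (μ : MeasureTheory.Measure X) (hμ : VarExp.IsMetricMeasure μ)
    (Q p s : X → ℝ)
    (hQ : VarExp.IsBddLogExponent μ Q) (hreg : VarExp.LowerAhlforsRegular μ Q)
    (hp : VarExp.IsBddLogExponent μ p) (hs : VarExp.IsBddLogExponent μ s)
    (hsp : VarExp.MuchLess μ Q (fun x => s x * p x)) :
    (∀ q : X → ENNReal, VarExp.IsExponent μ q →
      VarExp.EmbedsInHolder μ (VarExp.TriebelLizorkin μ s p q)
        (VarExp.triebelLizorkinNorm μ s p q) (fun x => s x - Q x / p x)) ∧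
    (∀ q : X → ENNReal, VarExp.IsExponent μ q → (∀ x, q x ≤ ENNReal.ofReal (p x)) →
      VarExp.EmbedsInHolder μ (VarExp.Besov μ s p q)
        (VarExp.besovNorm μ s p q) (fun x => s x - Q x / p x)) ∧
    (∀ (q : X → ENNReal) (t : X → ℝ), VarExp.IsExponent μ q → VarExp.IsBddLogExponent μ t →
      VarExp.MuchLess μ Q (fun x => t x * p x) →
      VarExp.MuchLess μ (fun x => t x * p x) (fun x => s x * p x) →
      VarExp.EmbedsInHolder μ (VarExp.Besov μ s p q)
        (VarExp.besovNorm μ s p q) (fun x => t x - Q x / p x)) :=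
  ⟨fun _ hq => VarExp.triebelLizorkin_embedsInHolder hμ hQ hreg hp hs hsp hq,
    fun _ hq hqp => VarExp.besov_embedsInHolder_of_le hμ hQ hreg hp hs hsp hq hqp,
    fun _ _ hq ht htp htsp =>
      VarExp.besov_embedsInHolder_of_muchLess hμ hQ hreg hp hs ht hq htp htsp⟩
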